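/- Let $K$ be a field and let $\Gamma$ be a quiver (with arbitrary sets of vertices and arrows, and with each vertex regarded as a path of length zero). For paths $p,q$ with $t(p)=s(q)$, let $pq$ be the path consisting of the arrows of $p$ followed by those of $q$. Let $K[\Gamma]$ be the quiver algebra: the $K$-algebra, not necessarily with identity, with basis the paths of $\Gamma$, in which the product of paths $p$ and $q$ is $pq$ if $t(p)=s(q)$ and $0$ otherwise. Let $K\Gamma$ be the path coalgebra: the vector space with basis the paths of $\Gamma$, with $\Delta(p)=\sum_{qr=p}q\otimes r$, with $\varepsilon(v)=1$ for every vertex $v$, and with $\varepsilon(p)=0$ for every path $p$ of positive length. Let $\psi:K[\Gamma]\to (K\Gamma)^*$ be the morphism of algebras (without identity) given by $\psi(p)(q)=\delta_{p,q}$ for all paths $p,q$, where the dual $C^*$ of a coalgebra $C$ carries the convolution product. For a coalgebra $C$, let $C^{*rat}_l$ (respectively $C^{*rat}_r$) be the rational part of the left (respectively right) $C^*$-module $C^*$, that is, the set of all $f\in C^*$ for which there are finite families $(c_i)_i$ in $C$ and $(f_i)_i$ in $C^*$ with $c^*f=\sum_i c^*(c_i)f_i$ (respectively $fc^*=\sum_i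 c^*(c_i)f_i$) for all $c^*\in C^*$. The coalgebra $C$ is called left (respectively right) semiperfect if the category of left (respectively right) $C$-comodules has enough projectives. Then the following are equivalent. (i) $\operatorname{Im}(\psi)=(K\Gamma)^{*rat}_l$. (ii) $\operatorname{Im}(\psi)=(K\Gamma)^{*rat}_r$. (iii) For every vertex $v$ of $\Gamma$ there are only finitely many paths starting at $v$ and only finitely many paths ending at $v$. (iv) The path coalgebra $K\Gamma$ is left and right semiperfect. -/

import Mathlib

open scoped TensorProduct
open CategoryTheory

/-! ### Paths of a quiver -/

/-- A path of a quiver, with its source and its target; `Quiver.Path.nil` at a vertex `v` is the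
path of length zero identified with `v`. -/
structure QuiverPath (V : Type*) [Quiver V] where
  src : V
  tgt : V
  path : Quiver.Path src tgt

namespace QuiverPath

universe v w

variable {V : Type v} [Quiver.{w} V]

/-- The path of length zero at the vertex `v`. -/
def vertex (v : V) : QuiverPath V := ⟨v, v, Quiver.Path.nil⟩

open Classical in
/-- The path `pq` (the arrows of `p` followed by those of `q`) if `t(p) = s(q)`, and `none`
otherwise. -/
noncomputable def compose (p q : QuiverPath V) : Option (QuiverPath V) :=
  if h : p.tgt = q.src then some ⟨p.src, q.tgt, p.path.comp (q.path.cast h.symm rfl)⟩ else none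

theorem compose_mk {a b c : V} (p : Quiver.Path a b) (q : Quiver.Path b c) :
    compose ⟨a, b, p⟩ ⟨b, c, q⟩ = some ⟨a, c, p.comp q⟩ := by
  simp [compose]

theorem compose_of_ne {p q : QuiverPath V} (h : p.tgt ≠ q.src) : compose p q = none := by
  simp [compose, h]

/-- The list of all ways of cutting a path into an initial and a final piece. -/
def cuts {a : V} : {b : V} → Quiver.Path a b → List (Σ c : V, Quiver.Path a c × Quiver.Path c b)
  | _, .nil => [⟨a, .nil, .nil⟩]
  | _, .cons p e => (cuts p).map (fun x => ⟨x.1, x.2.1, x.2.2.cons e⟩) ++ [⟨_, p.cons e, .nil⟩]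

theorem mem_cuts {a b : V} (p : Quiver.Path a b) (c : V) (q : Quiver.Path a c)
    (r : Quiver.Path c b) : (⟨c, q, r⟩ : Σ c : V, Quiver.Path a c × Quiver.Path c b) ∈ cuts p ↔
      q.comp r = p := by
  induction p with
  | nil =>
    simp only [cuts, List.mem_singleton]
    constructor
    · intro h
      cases h
      rfl
    · intro h
      cases r with
      | nil => cases h; rfl
      | cons r e => exact absurd h (by simp)
  | cons p e ih =>
    simp only [cuts, List.mem_append, List.mem_map, List.mem_singleton]
    constructor
    · rintro (⟨⟨d, s, t⟩, hx, h⟩ | h)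
      · cases h
        rw [Quiver.Path.comp_cons, (ih _).1 hx]
      · cases h
        rfl
    · intro h
      cases r with
      | nil => right; cases h; rfl
      | cons r f =>
        left
        rw [Quiver.Path.comp_cons] at h
        cases h
        exact ⟨⟨c, q, r⟩, (ih _).2 rfl, rfl⟩

theorem nodup_cuts {a b : V} (p : Quiver.Path a b) : (cuts p).Nodup := by
  induction p with
  | nil => simp [cuts]
  | cons p e ih =>
    rw [cuts, List.nodup_append]
    refine ⟨ih.map ?_, by simp, ?_⟩
    · rintro ⟨c, q, r⟩ ⟨c', q', r'⟩ h
      cases h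
      rfl
    · rintro x hx y hy rfl
      rw [List.mem_singleton] at hy
      obtain ⟨⟨c, q, r⟩, -, rfl⟩ := List.mem_map.1 hx
      exact absurd (congrArg (fun z => z.2.2.length) hy) (by simp)

/-- A cut of a path, as a pair of paths. -/
def ofCut {a b : V} (x : Σ c : V, Quiver.Path a c × Quiver.Path c b) :
    QuiverPath V × QuiverPath V := (⟨a, x.1, x.2.1⟩, ⟨x.1, b, x.2.2⟩)

theorem ofCut_injective {a b : V} : Function.Injective (ofCut (a := a) (b := b)) := by
  rintro ⟨c, q, r⟩ ⟨c', q', r'⟩ h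
  cases h
  rfl

/-- The finite set of all pairs `(q, r)` of paths with `qr = p`; see `mem_factorizations`. -/
def factorizations (p : QuiverPath V) : Finset (QuiverPath V × QuiverPath V) :=
  ⟨((cuts p.path).map ofCut : List _), (nodup_cuts p.path).map ofCut_injective⟩

theorem mem_factorizations (p q r : QuiverPath V) :
    (q, r) ∈ p.factorizations ↔ compose q r = some p := by
  obtain ⟨a, b, p⟩ := p
  obtain ⟨a', c, q⟩ := q
  obtain ⟨c', b', r⟩ := r
  change _ ∈ (cuts p).map ofCut ↔ _
  rw [List.mem_map]
  constructor
  · rintro ⟨⟨d, s, t⟩, hx, h⟩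
    cases h
    rw [compose_mk, (mem_cuts _ _ _ _).1 hx]
  · intro h
    by_cases hc : c = c'
    · subst hc
      rw [compose_mk] at h
      cases h
      exact ⟨⟨c, q, r⟩, (mem_cuts _ _ _ _).2 rfl, rfl⟩
    · rw [compose_of_ne hc] at h
      cases h

theorem sum_factorizations {M : Type*} [AddCommMonoid M] {a b : V} (p : Quiver.Path a b)
    (F : QuiverPath V × QuiverPath V → M) :
    ∑ x ∈ factorizations ⟨a, b, p⟩, F x =
      ((cuts p).map fun x => F (⟨a, x.1, x.2.1⟩, ⟨x.1, b, x.2.2⟩)).sum := by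
  simp [factorizations, Finset.sum, ofCut, Function.comp_def]

theorem sum_cuts_cuts {M : Type*} [AddCommMonoid M] {a b : V} (p : Quiver.Path a b)
    (F : (c d : V) → Quiver.Path a c → Quiver.Path c d → Quiver.Path d b → M) :
    ((cuts p).map fun x => ((cuts x.2.2).map fun y => F x.1 y.1 x.2.1 y.2.1 y.2.2).sum).sum =
      ((cuts p).map fun x => ((cuts x.2.1).map fun y => F y.1 x.1 y.2.1 y.2.2 x.2.2).sum).sum := by
  induction p with
  | nil => simp [cuts]
  | cons p e ih =>
    have := ih (fun c d q r s => F c d q r (s.cons e))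
    simp only [cuts, List.map_append, List.map_map, Function.comp_def, List.map_cons,
      List.map_nil, List.sum_append, List.sum_cons, List.sum_nil, List.sum_map_add, add_zero]
    rw [this, add_assoc]

end QuiverPath

/-! ### The path coalgebra -/

/-- The path coalgebra `KΓ`: the vector space with basis the paths of the quiver, with
`Δ(p) = ∑_{qr = p} q ⊗ r`, `ε(v) = 1` for a vertex and `ε(p) = 0` for a path of positive length. -/
def PathCoalgebra (K V : Type*) [Field K] [Quiver V] := QuiverPath V →₀ K

namespace PathCoalgebra

open QuiverPath

universe u v w

variable (K : Type u) (V : Type v) [Field K] [Quiver.{w} V]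

noncomputable instance : AddCommGroup (PathCoalgebra K V) :=
  inferInstanceAs (AddCommGroup (QuiverPath V →₀ K))

noncomputable instance : Module K (PathCoalgebra K V) :=
  inferInstanceAs (Module K (QuiverPath V →₀ K))

/-- The basis of paths. -/
noncomputable def basis : Module.Basis (QuiverPath V) K (PathCoalgebra K V) :=
  Module.Basis.ofRepr (LinearEquiv.refl K (QuiverPath V →₀ K))

noncomputable instance : CoalgebraStruct K (PathCoalgebra K V) where
  comul := (basis K V).constr K fun p =>
    ∑ x ∈ p.factorizations, basis K V x.1 ⊗ₜ[K] basis K V x.2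
  counit := (basis K V).constr K fun p => if p.path.length = 0 then 1 else 0

variable {K V}

theorem comul_basis (p : QuiverPath V) :
    Coalgebra.comul (R := K) (basis K V p) =
      ∑ x ∈ p.factorizations, basis K V x.1 ⊗ₜ[K] basis K V x.2 :=
  Module.Basis.constr_basis _ _ _ _

theorem counit_basis (p : QuiverPath V) :
    Coalgebra.counit (R := K) (basis K V p) = if p.path.length = 0 then 1 else 0 :=
  Module.Basis.constr_basis _ _ _ _

theorem comul_mk {a b : V} (p : Quiver.Path a b) :
    Coalgebra.comul (R := K) (basis K V ⟨a, b, p⟩) =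
      ((cuts p).map fun x =>
        basis K V ⟨a, x.1, x.2.1⟩ ⊗ₜ[K] basis K V ⟨x.1, b, x.2.2⟩).sum := by
  rw [comul_basis, sum_factorizations]

theorem sum_counit_left {a b : V} (p : Quiver.Path a b) {M : Type*} [AddCommGroup M] [Module K M]
    (F : (c : V) → Quiver.Path c b → M) :
    ((cuts p).map fun x => (if x.2.1.length = 0 then (1 : K) else 0) • F x.1 x.2.2).sum =
      F a p := by
  induction p with
  | nil => simp [cuts]
  | cons p e ih =>
    have := ih (fun c q => F c (q.cons e))
    simp only [cuts, List.map_append, List.map_map, Function.comp_def, List.map_cons,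
      List.map_nil, List.sum_append, List.sum_cons, List.sum_nil, add_zero]
    rw [this]
    simp

theorem sum_counit_right {a b : V} (p : Quiver.Path a b) {M : Type*} [AddCommGroup M] [Module K M]
    (F : (c : V) → Quiver.Path a c → M) :
    ((cuts p).map fun x => (if x.2.2.length = 0 then (1 : K) else 0) • F x.1 x.2.1).sum =
      F b p := by
  cases p with
  | nil => simp [cuts]
  | cons p e => simp [cuts, Function.comp_def]

noncomputable instance : Coalgebra K (PathCoalgebra K V) where
  coassoc := by
    refine (basis K V).ext ?_
    rintro ⟨a, b, p⟩
    simp only [LinearMap.comp_apply, LinearEquiv.coe_coe, comul_mk, map_list_sum, List.map_map,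
      Function.comp_def, LinearMap.rTensor_tmul, LinearMap.lTensor_tmul]
    have h1 : ∀ (y : PathCoalgebra K V) (l : List (PathCoalgebra K V ⊗[K] PathCoalgebra K V)),
        TensorProduct.assoc K _ _ _ (l.sum ⊗ₜ[K] y) =
          (l.map fun z => TensorProduct.assoc K _ _ _ (z ⊗ₜ[K] y)).sum := by
      intro y l
      induction l with
      | nil => simp
      | cons z l ih => simp [TensorProduct.add_tmul, ih]
    have h2 : ∀ (y : PathCoalgebra K V) (l : List (PathCoalgebra K V ⊗[K] PathCoalgebra K V)),
        y ⊗ₜ[K] l.sum = (l.map fun z => y ⊗ₜ[K] z).sum := by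
      intro y l
      induction l with
      | nil => simp
      | cons z l ih => simp [TensorProduct.tmul_add, ih]
    simp only [h1, h2, List.map_map, Function.comp_def, TensorProduct.assoc_tmul]
    exact (sum_cuts_cuts p fun c d q r s =>
      basis K V ⟨a, c, q⟩ ⊗ₜ[K] (basis K V ⟨c, d, r⟩ ⊗ₜ[K] basis K V ⟨d, b, s⟩)).symm
  rTensor_counit_comp_comul := by
    refine (basis K V).ext ?_
    rintro ⟨a, b, p⟩
    simp only [LinearMap.comp_apply, comul_mk, map_list_sum, List.map_map,
      Function.comp_def, LinearMap.rTensor_tmul, counit_basis, TensorProduct.mk_apply]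
    rw [← sum_counit_left (K := K) p fun c q => (1 : K) ⊗ₜ[K] basis K V ⟨c, b, q⟩]
    simp only [TensorProduct.smul_tmul', smul_eq_mul, mul_one]
  lTensor_counit_comp_comul := by
    refine (basis K V).ext ?_
    rintro ⟨a, b, p⟩
    simp only [LinearMap.comp_apply, comul_mk, map_list_sum, List.map_map,
      Function.comp_def, LinearMap.lTensor_tmul, counit_basis, TensorProduct.mk_apply,
      LinearMap.flip_apply]
    rw [← sum_counit_right (K := K) p fun c q => basis K V ⟨a, c, q⟩ ⊗ₜ[K] (1 : K)]
    simp only [← TensorProduct.tmul_smul, smul_eq_mul, mul_one]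

end PathCoalgebra

/-! ### The quiver algebra -/

/-- The quiver algebra `K[Γ]`: the vector space with basis the paths of the quiver, where the
product of the paths `p` and `q` is `pq` if `t(p) = s(q)`, and `0` otherwise. In general it has no
identity. -/
def QuiverAlgebra (K V : Type*) [Field K] [Quiver V] := QuiverPath V →₀ K

namespace QuiverAlgebra

open QuiverPath

universe u v w

variable (K : Type u) (V : Type v) [Field K] [Quiver.{w} V]

noncomputable instance : AddCommGroup (QuiverAlgebra K V) :=
  inferInstanceAs (AddCommGroup (QuiverPath V →₀ K))

noncomputable instance : Module K (QuiverAlgebra K V) :=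
  inferInstanceAs (Module K (QuiverPath V →₀ K))

/-- The basis of paths. -/
noncomputable def basis : Module.Basis (QuiverPath V) K (QuiverAlgebra K V) :=
  Module.Basis.ofRepr (LinearEquiv.refl K (QuiverPath V →₀ K))

/-- The multiplication, as a bilinear map. -/
noncomputable def mulMap : QuiverAlgebra K V →ₗ[K] QuiverAlgebra K V →ₗ[K] QuiverAlgebra K V :=
  (basis K V).constr K fun p => (basis K V).constr K fun q => (compose p q).elim 0 (basis K V)

noncomputable instance : Mul (QuiverAlgebra K V) where
  mul x y := mulMap K V x y

variable {K V}

theorem basis_mul_basis (p q : QuiverPath V) :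
    basis K V p * basis K V q = (compose p q).elim 0 (basis K V) := by
  change mulMap K V _ _ = _
  simp [mulMap]

theorem mulMap_basis_assoc (p q r : QuiverPath V) :
    mulMap K V (mulMap K V (basis K V p) (basis K V q)) (basis K V r) =
      mulMap K V (basis K V p) (mulMap K V (basis K V q) (basis K V r)) := by
  obtain ⟨a, b, p⟩ := p
  obtain ⟨b', c, q⟩ := q
  obtain ⟨c', d, r⟩ := r
  by_cases h1 : b = b'
  · subst h1
    by_cases h2 : c = c'
    · subst h2
      simp [mulMap, compose_mk]
    · have h : ∀ (x : V) (s : Quiver.Path x c), compose ⟨x, c, s⟩ ⟨c', d, r⟩ = none :=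
        fun x s => compose_of_ne h2
      simp [mulMap, compose_mk, h]
  · have h : ∀ (x : V) (s : Quiver.Path b' x), compose ⟨a, b, p⟩ ⟨b', x, s⟩ = none :=
      fun x s => compose_of_ne h1
    by_cases h2 : c = c'
    · subst h2
      simp [mulMap, compose_mk, h]
    · have h' : compose ⟨b', c, q⟩ ⟨c', d, r⟩ = none := compose_of_ne h2
      simp [mulMap, h, h']

noncomputable instance : NonUnitalRing (QuiverAlgebra K V) where
  left_distrib x y z := (mulMap K V x).map_add y z
  right_distrib x y z := (mulMap K V).map_add₂ x y z
  zero_mul x := (mulMap K V).map_zero₂ x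
  mul_zero x := (mulMap K V x).map_zero
  mul_assoc x y z := by
    change mulMap K V (mulMap K V x y) z = mulMap K V x (mulMap K V y z)
    have hx (p q : QuiverPath V) (z : QuiverAlgebra K V) :
        mulMap K V (mulMap K V (basis K V p) (basis K V q)) z =
          mulMap K V (basis K V p) (mulMap K V (basis K V q) z) :=
      LinearMap.congr_fun (f := mulMap K V (mulMap K V (basis K V p) (basis K V q)))
        (g := (mulMap K V (basis K V p)).comp (mulMap K V (basis K V q)))
        ((basis K V).ext fun r => mulMap_basis_assoc p q r) z
    have hy (p : QuiverPath V) (y z : QuiverAlgebra K V) :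
        mulMap K V (mulMap K V (basis K V p) y) z =
          mulMap K V (basis K V p) (mulMap K V y z) :=
      LinearMap.congr_fun (f := ((mulMap K V).flip z).comp (mulMap K V (basis K V p)))
        (g := (mulMap K V (basis K V p)).comp ((mulMap K V).flip z))
        ((basis K V).ext fun q => hx p q z) y
    exact LinearMap.congr_fun (f := ((mulMap K V).flip z).comp ((mulMap K V).flip y))
      (g := (mulMap K V).flip (mulMap K V y z)) ((basis K V).ext fun p => hy p y z) x

instance : IsScalarTower K (QuiverAlgebra K V) (QuiverAlgebra K V) where
  smul_assoc k x y := (mulMap K V).map_smul₂ k x y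

instance : SMulCommClass K (QuiverAlgebra K V) (QuiverAlgebra K V) where
  smul_comm k x y := ((mulMap K V x).map_smul k y).symm

/-- The linear map `ψ` with `ψ(p)(q) = δ_{p,q}` for all paths `p` and `q`. -/
noncomputable def toDualLinear :
    QuiverAlgebra K V →ₗ[K] WithConv (PathCoalgebra K V →ₗ[K] K) :=
  (basis K V).constr K fun p => WithConv.toConv ((PathCoalgebra.basis K V).coord p)

open Classical in
theorem toDualLinear_basis_apply (p q : QuiverPath V) :
    (toDualLinear (basis K V p)).ofConv (PathCoalgebra.basis K V q) = if p = q then 1 else 0 := by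
  simp [toDualLinear, Finsupp.single_apply, eq_comm]

theorem toDualLinear_mul_basis (p q : QuiverPath V) :
    toDualLinear (K := K) (basis K V p * basis K V q) =
      toDualLinear (basis K V p) * toDualLinear (basis K V q) := by
  classical
  apply WithConv.ext
  refine (PathCoalgebra.basis K V).ext fun r => ?_
  rw [LinearMap.convMul_def, basis_mul_basis]
  simp only [LinearMap.comp_apply, PathCoalgebra.comul_basis, map_sum, TensorProduct.map_tmul,
    LinearMap.mul'_apply, toDualLinear_basis_apply, ← ite_and, mul_ite, mul_one, mul_zero]
  have h : ∀ x : QuiverPath V × QuiverPath V, (q = x.2 ∧ p = x.1) ↔ (p, q) = x := by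
    rintro ⟨a, b⟩
    simp [and_comm]
  simp only [h, Finset.sum_ite_eq, mem_factorizations]
  cases hc : compose p q with
  | none => simp
  | some s => simp [toDualLinear_basis_apply]

/-- The morphism `ψ : K[Γ] → (KΓ)^*` of algebras (not necessarily with identity), where
`ψ(p)(q) = δ_{p,q}` for all paths `p` and `q`. -/
noncomputable def toDual :
    QuiverAlgebra K V →ₙₐ[K] WithConv (PathCoalgebra K V →ₗ[K] K) where
  toFun := toDualLinear
  map_smul' := toDualLinear.map_smul
  map_zero' := toDualLinear.map_zero
  map_add' := toDualLinear.map_add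
  map_mul' x y := by
    have hx (p : QuiverPath V) (y : QuiverAlgebra K V) :
        toDualLinear (K := K) (basis K V p * y) =
          toDualLinear (basis K V p) * toDualLinear y :=
      LinearMap.congr_fun (f := toDualLinear.comp (mulMap K V (basis K V p)))
        (g := (LinearMap.mulLeft K (toDualLinear (basis K V p))).comp toDualLinear)
        ((basis K V).ext fun q => toDualLinear_mul_basis p q) y
    exact LinearMap.congr_fun (f := toDualLinear.comp ((mulMap K V).flip y))
        (g := (LinearMap.mulRight K (toDualLinear y)).comp toDualLinear)
        ((basis K V).ext fun p => hx p y) x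

end QuiverAlgebra

/-! ### Rational parts of the dual of a coalgebra -/

section Rational

universe u v

variable (K : Type u) (C : Type v) [Field K] [AddCommGroup C] [Module K C] [Coalgebra K C]

/-- The rational part of the left `C^*`-module `C^*`: all `f` for which there are finite families
`(c_i)` in `C` and `(f_i)` in `C^*` with `d f = ∑ i, d(c_i) f_i` for every `d` in `C^*`. Here the
product of `C^* = WithConv (C →ₗ[K] K)` is the convolution product. -/
def leftRationalPart : Set (WithConv (C →ₗ[K] K)) :=
  {f | ∃ (n : ℕ) (c : Fin n → C) (g : Fin n → WithConv (C →ₗ[K] K)),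
    ∀ d : WithConv (C →ₗ[K] K), d * f = ∑ i, d.ofConv (c i) • g i}

/-- The rational part of the right `C^*`-module `C^*`: all `f` for which there are finite families
`(c_i)` in `C` and `(f_i)` in `C^*` with `f d = ∑ i, d(c_i) f_i` for every `d` in `C^*`. -/
def rightRationalPart : Set (WithConv (C →ₗ[K] K)) :=
  {f | ∃ (n : ℕ) (c : Fin n → C) (g : Fin n → WithConv (C →ₗ[K] K)),
    ∀ d : WithConv (C →ₗ[K] K), f * d = ∑ i, d.ofConv (c i) • g i}

end Rational

/-! ### Comodules and semiperfect coalgebras -/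

/-- A right comodule over the coalgebra `C`, with coaction `ρ : M → M ⊗ C`. -/
structure RightComodule (K C : Type*) [Field K] [AddCommGroup C] [Module K C]
    [Coalgebra K C] where
  carrier : Type*
  [addCommGroup : AddCommGroup carrier]
  [module : Module K carrier]
  coact : carrier →ₗ[K] carrier ⊗[K] C
  coassoc : (TensorProduct.assoc K carrier C C).toLinearMap ∘ₗ coact.rTensor C ∘ₗ coact =
    (Coalgebra.comul (R := K) (A := C)).lTensor carrier ∘ₗ coact
  lTensor_counit_comp_coact : (Coalgebra.counit (R := K) (A := C)).lTensor carrier ∘ₗ coact =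
    (TensorProduct.mk K carrier K).flip 1

/-- A left comodule over the coalgebra `C`, with coaction `ρ : M → C ⊗ M`. -/
structure LeftComodule (K C : Type*) [Field K] [AddCommGroup C] [Module K C]
    [Coalgebra K C] where
  carrier : Type*
  [addCommGroup : AddCommGroup carrier]
  [module : Module K carrier]
  coact : carrier →ₗ[K] C ⊗[K] carrier
  coassoc : (TensorProduct.assoc K C C carrier).toLinearMap ∘ₗ
      (Coalgebra.comul (R := K) (A := C)).rTensor carrier ∘ₗ coact =
    coact.lTensor C ∘ₗ coact
  rTensor_counit_comp_coact : (Coalgebra.counit (R := K) (A := C)).rTensor carrier ∘ₗ coact =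
    TensorProduct.mk K K carrier 1

attribute [instance] RightComodule.addCommGroup RightComodule.module
attribute [instance] LeftComodule.addCommGroup LeftComodule.module

section Semiperfect

universe u v t

variable (K : Type u) (C : Type v) [Field K] [AddCommGroup C] [Module K C] [Coalgebra K C]

/-- Morphisms of right comodules: linear maps which commute with the coactions. -/
@[ext]
structure RightComodule.Hom {K : Type u} {C : Type v} [Field K] [AddCommGroup C] [Module K C]
    [Coalgebra K C] (M N : RightComodule.{u, v, t} K C) where
  toLinearMap : M.carrier →ₗ[K] N.carrier
  comm : N.coact ∘ₗ toLinearMap = toLinearMap.rTensor C ∘ₗ M.coact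

/-- Morphisms of left comodules: linear maps which commute with the coactions. -/
@[ext]
structure LeftComodule.Hom {K : Type u} {C : Type v} [Field K] [AddCommGroup C] [Module K C]
    [Coalgebra K C] (M N : LeftComodule.{u, v, t} K C) where
  toLinearMap : M.carrier →ₗ[K] N.carrier
  comm : N.coact ∘ₗ toLinearMap = toLinearMap.lTensor C ∘ₗ M.coact

/-- The category of right `C`-comodules. -/
instance : Category (RightComodule.{u, v, t} K C) where
  Hom M N := RightComodule.Hom M N
  id M := ⟨LinearMap.id, by simp⟩
  comp f g := ⟨g.toLinearMap ∘ₗ f.toLinearMap, by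
    rw [← LinearMap.comp_assoc, g.comm, LinearMap.comp_assoc, f.comm, ← LinearMap.comp_assoc,
      ← LinearMap.rTensor_comp]⟩

/-- The category of left `C`-comodules. -/
instance : Category (LeftComodule.{u, v, t} K C) where
  Hom M N := LeftComodule.Hom M N
  id M := ⟨LinearMap.id, by simp⟩
  comp f g := ⟨g.toLinearMap ∘ₗ f.toLinearMap, by
    rw [← LinearMap.comp_assoc, g.comm, LinearMap.comp_assoc, f.comm, ← LinearMap.comp_assoc,
      ← LinearMap.lTensor_comp]⟩

/-- `C` is right semiperfect if the category of right `C`-comodules has enough projectives. -/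
def IsRightSemiperfect : Prop := EnoughProjectives (RightComodule.{u, v, max u v} K C)

/-- `C` is left semiperfect if the category of left `C`-comodules has enough projectives. -/
def IsLeftSemiperfect : Prop := EnoughProjectives (LeftComodule.{u, v, max u v} K C)

end Semiperfect

/-! ### Path systems -/

/-! A functional on the path coalgebra is an arbitrary function `f` on paths, and the image of `ψ`
consists of the finitely supported ones. In `d * f` the value at `r` is the sum of `d(q) f(s)` over
`qs = r`, so `f` is left rational exactly when only finitely many paths `q` have a nonzero translate
`δ_q * f` (`isRational_iff`), that is, when only finitely many paths end at sources of paths in the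
support of `f`. If image and rational part agree, testing on a vertex `v` shows that finitely many
paths end at `v`. The indicator of all paths starting at `v` is then rational, hence finitely
supported. Conversely, both finiteness conditions make rationality and finite support equivalent.
Reversing all paths exchanges left and right and preserves the combined condition, which is why the
argument is carried out for a `PathSystem` with an opposite.

For semiperfectness, the coefficients of a coaction turn a right comodule into a space with locally
finite operators `E_p` satisfying `E_p E_q = E_{pq}`, or `0` if `p` and `q` do not compose; left
comodules give the same for reversed paths. There are enough such projectives exactly when finitely
many paths end at each vertex (`PathRep.enoughProjectives_iff`). Under this finiteness, left
multiplication on paths is locally finite, and copies of it are projective and cover everything.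
Conversely, let a projective `Q` map onto the simple representation at `v`, with `x` mapping to its
generator. For each path `p` ending at `v`, the final pieces of `p` span a representation with this
simple quotient; lifting `Q` to it shows `E_p x ≠ 0`. Local finiteness at `x` then bounds the number
of such `p`. -/

/-- A partial multiplication on a set `P` of paths with endpoints in `V`, with a length function
and finitely many factorizations of each path. -/
structure PathSystem (P V : Type*) where
  src : P → V
  tgt : P → V
  unit : V → P
  comp : P → P → Option P
  factors : P → Finset (P × P)
  len : P → ℕ
  mem_factors : ∀ {p q r}, (q, r) ∈ factors p ↔ comp q r = some p
  comp_assoc : ∀ p q r, (comp p q).bind (fun x => comp x r) = (comp q r).bind (comp p)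
  comp_eq_none : ∀ {p q}, tgt p ≠ src q → comp p q = none
  src_comp : ∀ {p q r}, comp p q = some r → src r = src p
  tgt_comp : ∀ {p q r}, comp p q = some r → tgt r = tgt q
  src_unit : ∀ v, src (unit v) = v
  tgt_unit : ∀ v, tgt (unit v) = v
  unit_comp : ∀ p, comp (unit (src p)) p = some p
  comp_unit : ∀ p, comp p (unit (tgt p)) = some p
  len_comp : ∀ {p q r}, comp p q = some r → len r = len p + len q
  len_unit : ∀ v, len (unit v) = 0
  eq_unit : ∀ {p}, len p = 0 → ∃ v, p = unit v

namespace PathSystem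

variable {P V : Type*} (S : PathSystem P V)

/-- The path system with all paths reversed. -/
def op : PathSystem P V where
  src := S.tgt
  tgt := S.src
  unit := S.unit
  comp p q := S.comp q p
  factors p := (S.factors p).map (Equiv.prodComm P P).toEmbedding
  len := S.len
  mem_factors := by
    intro p q r
    rw [← S.mem_factors]
    simp
  comp_assoc p q r := (S.comp_assoc r q p).symm
  comp_eq_none h := S.comp_eq_none h.symm
  src_comp := S.tgt_comp
  tgt_comp := S.src_comp
  src_unit := S.tgt_unit
  tgt_unit := S.src_unit
  unit_comp := S.comp_unit
  comp_unit := S.unit_comp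
  len_comp h := (S.len_comp h).trans (add_comm _ _)
  len_unit := S.len_unit
  eq_unit := S.eq_unit

variable {S}

theorem eq_of_unit_comp {u p r : P} (hu : S.len u = 0) (h : S.comp u p = some r) :
    u = S.unit (S.src p) ∧ r = p := by
  obtain ⟨v, rfl⟩ := S.eq_unit hu
  have hv : v = S.src p := by
    by_contra hv
    rw [S.comp_eq_none (by rwa [S.tgt_unit])] at h
    cases h
  subst hv
  rw [S.unit_comp] at h
  exact ⟨rfl, (Option.some.inj h).symm⟩

theorem eq_of_comp_unit {u p r : P} (hu : S.len u = 0) (h : S.comp p u = some r) :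
    u = S.unit (S.tgt p) ∧ r = p :=
  eq_of_unit_comp (S := S.op) hu h

/-! ### Rational functionals on paths -/

/-- The functional `f` on paths generates a finite-dimensional rational submodule for the
convolution product `(d * f)(r) = ∑_{qs = r} d(q) f(s)`. -/
def IsRational {K : Type*} [Field K] (S : PathSystem P V) (f : P → K) : Prop :=
  ∃ (n : ℕ) (c : Fin n → P →₀ K) (g : Fin n → P → K), ∀ (d : P → K) (r : P),
    ∑ x ∈ S.factors r, d x.1 * f x.2 = ∑ i, ((c i).sum fun p a => a * d p) * g i r

-- The set collects the `q` whose indicator has a nonzero product with `f`. If `d * f` depends on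
-- `d` only through finitely many `d(c i)`, it ignores `d` outside the union of the supports of the
-- `c i`. Conversely, `d * f` is the sum of the `d q` times these translates, which is finite.
open Classical in
theorem isRational_iff {K : Type*} [Field K] (f : P → K) :
    S.IsRational f ↔
      {q | ∃ r, ∑ x ∈ S.factors r, (if x.1 = q then f x.2 else 0) ≠ 0}.Finite := by
  constructor
  · rintro ⟨n, c, g, h⟩
    refine (Finset.univ.biUnion fun i => (c i).support).finite_toSet.subset ?_
    rintro q ⟨r, hr⟩
    by_contra hq
    simp only [Finset.coe_biUnion, Set.mem_iUnion, not_exists, Finset.mem_coe,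
      Finsupp.mem_support_iff, not_not, Finset.mem_univ] at hq
    apply hr
    have := h (fun p => if p = q then 1 else 0) r
    simp only [ite_mul, one_mul, zero_mul] at this
    rw [this]
    refine Finset.sum_eq_zero fun i _ => ?_
    rw [Finsupp.sum, Finset.sum_eq_zero, zero_mul]
    intro p _
    split_ifs with hp
    · subst hp; simp [hq i trivial]
    · simp
  · intro hfin
    let e := hfin.toFinset.equivFin
    refine ⟨_, fun i => Finsupp.single (e.symm i).1 1,
      fun i r => ∑ x ∈ S.factors r, (if x.1 = (e.symm i).1 then f x.2 else 0), fun d r => ?_⟩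
    simp only [Finsupp.sum_single_index, zero_mul, one_mul]
    rw [e.symm.sum_comp fun q : hfin.toFinset =>
      d q.1 * ∑ x ∈ S.factors r, (if x.1 = q.1 then f x.2 else 0),
      Finset.sum_coe_sort hfin.toFinset fun q =>
      d q * ∑ x ∈ S.factors r, (if x.1 = q then f x.2 else 0)]
    -- Enlarging the index set by the first factors of `r` adds only zeros. After the sums are
    -- exchanged, each factorization then meets its own first factor in the inner sum.
    have hsub : ∑ q ∈ hfin.toFinset, d q * ∑ x ∈ S.factors r, (if x.1 = q then f x.2 else 0) =
        ∑ q ∈ hfin.toFinset ∪ (S.factors r).image Prod.fst,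
          d q * ∑ x ∈ S.factors r, (if x.1 = q then f x.2 else 0) := by
      refine Finset.sum_subset Finset.subset_union_left fun q _ hq => ?_
      rw [Set.Finite.mem_toFinset, Set.mem_ofPred_eq, not_exists] at hq
      rw [not_not.1 (hq r), mul_zero]
    rw [hsub]
    simp only [Finset.mul_sum]
    rw [Finset.sum_comm]
    refine Finset.sum_congr rfl fun x hx => ?_
    simp only [mul_ite, mul_zero]
    rw [Finset.sum_ite_eq, if_pos]
    exact Finset.mem_union_right _ (Finset.mem_image_of_mem _ hx)

theorem isRational_of_finite {K : Type*} [Field K] {f : P → K}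
    (h : {q | ∃ s, f s ≠ 0 ∧ S.tgt q = S.src s}.Finite) : S.IsRational f := by
  classical
  rw [isRational_iff]
  refine h.subset ?_
  rintro q ⟨r, hr⟩
  obtain ⟨⟨q', s⟩, hx, hne⟩ := Finset.exists_ne_zero_of_sum_ne_zero hr
  simp only [ne_eq, ite_eq_right_iff, Classical.not_imp] at hne
  obtain ⟨rfl, hne⟩ := hne
  refine ⟨s, hne, ?_⟩
  by_contra ht
  rw [S.mem_factors, S.comp_eq_none ht] at hx
  cases hx

/-- For `s` in the support, the trivial path at its source has a translate of `f` with value `f s ≠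
0` at `s`, since trivial paths cancel. Distinct sources give distinct trivial paths. -/
theorem finite_src_of_isRational {K : Type*} [Field K] {f : P → K} (h : S.IsRational f) :
    (S.src '' f.support).Finite := by
  classical
  rw [isRational_iff] at h
  refine (h.image S.src).subset ?_
  rintro _ ⟨s, hs, rfl⟩
  refine ⟨S.unit (S.src s), ⟨s, ?_⟩, S.src_unit _⟩
  rw [Finset.sum_eq_single (S.unit (S.src s), s)]
  · simpa using hs
  · rintro ⟨q, t⟩ hx hne
    rw [if_neg]
    rintro rfl
    obtain ⟨-, rfl⟩ := eq_of_unit_comp (S.len_unit _) (S.mem_factors.1 hx)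
    exact hne rfl
  · intro hx
    exact absurd (S.mem_factors.2 (S.unit_comp s)) hx

-- Translating the indicator of a vertex by any `q` ending there gives a function with value `1` at
-- `q` itself.
open Classical in
theorem finite_tgt_of_isRational {K : Type*} [Field K] {v : V}
    (h : S.IsRational (K := K) (fun s => if s = S.unit v then 1 else 0)) :
    {p | S.tgt p = v}.Finite := by
  rw [isRational_iff] at h
  refine h.subset ?_
  rintro q rfl
  refine ⟨q, ?_⟩
  rw [Finset.sum_eq_single (q, S.unit (S.tgt q))]
  · simp
  · rintro ⟨q', t⟩ hx hne
    by_cases h1 : q' = q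
    · by_cases h2 : t = S.unit (S.tgt q)
      · exact absurd (by rw [h1, h2]) hne
      · simp [h2]
    · simp [h1]
  · intro hx
    exact absurd (S.mem_factors.2 (S.comp_unit q)) hx

theorem finite_support_iff_isRational_iff (K : Type*) [Field K] (S : PathSystem P V) :
    (∀ f : P → K, f.support.Finite ↔ S.IsRational f) ↔
      ∀ v, {p | S.src p = v}.Finite ∧ {p | S.tgt p = v}.Finite := by
  classical
  constructor
  · intro h
    have htgt (v : V) : {p | S.tgt p = v}.Finite := by
      refine finite_tgt_of_isRational (K := K) ((h _).1 ?_)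
      refine (Set.finite_singleton (S.unit v)).subset fun s hs => ?_
      by_contra hne
      exact hs (if_neg hne)
    refine fun v => ⟨?_, htgt v⟩
    -- Rationality needs only that few paths end at `v`; the support, all paths starting at `v`, is
    -- not yet known to be finite.
    have hrat : S.IsRational (K := K) (fun s => if S.src s = v then 1 else 0) := by
      refine isRational_of_finite ((htgt v).subset ?_)
      rintro q ⟨s, hs, hq⟩
      by_contra hne
      exact hs (if_neg fun hv => hne (hq.trans hv))
    refine ((h _).2 hrat).subset fun s hs => ?_
    rw [Function.mem_support, if_pos (show S.src s = v from hs)]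
    exact one_ne_zero
  · intro h f
    constructor
    · intro hf
      refine isRational_of_finite ((hf.biUnion fun s _ => (h (S.src s)).2).subset ?_)
      rintro q ⟨s, hs, hq⟩
      exact Set.mem_biUnion (Function.mem_support.2 hs) hq
    · intro hf
      refine ((finite_src_of_isRational hf).biUnion fun v _ => (h v).1).subset fun s hs => ?_
      exact Set.mem_biUnion (Set.mem_image_of_mem _ hs) rfl

end PathSystem

/-! ### The path system of a quiver -/

namespace QuiverPath

universe v w

variable (V : Type v) [Quiver.{w} V]

/-- The path system of all paths of a quiver. -/
noncomputable def system : PathSystem (QuiverPath V) V where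
  src := src
  tgt := tgt
  unit := vertex
  comp := compose
  factors := factorizations
  len p := p.path.length
  mem_factors := mem_factorizations _ _ _
  comp_assoc := by
    rintro ⟨a, b, p⟩ ⟨b', c, q⟩ ⟨c', d, r⟩
    by_cases h1 : b = b'
    · subst h1
      by_cases h2 : c = c'
      · subst h2
        simp [compose_mk]
      · have h : ∀ (x : V) (s : Quiver.Path x c), compose ⟨x, c, s⟩ ⟨c', d, r⟩ = none :=
          fun x s => compose_of_ne h2
        simp [compose_mk, h]
    · have h : ∀ (x : V) (s : Quiver.Path b' x), compose ⟨a, b, p⟩ ⟨b', x, s⟩ = none :=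
        fun x s => compose_of_ne h1
      by_cases h2 : c = c'
      · subst h2
        simp [compose_mk, h]
      · have h' : compose ⟨b', c, q⟩ ⟨c', d, r⟩ = none := compose_of_ne h2
        simp [h, h']
  comp_eq_none := compose_of_ne
  src_comp := by
    intro p q r h
    unfold compose at h
    split_ifs at h
    cases h
    rfl
  tgt_comp := by
    intro p q r h
    unfold compose at h
    split_ifs at h
    cases h
    rfl
  src_unit _ := rfl
  tgt_unit _ := rfl
  unit_comp := by
    rintro ⟨a, b, p⟩
    simp [vertex, compose_mk]
  comp_unit := by
    rintro ⟨a, b, p⟩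
    simp [vertex, compose_mk]
  len_comp := by
    rintro ⟨a, b, p⟩ ⟨b', c, q⟩ r h
    by_cases h1 : b = b'
    · subst h1
      rw [compose_mk] at h
      cases h
      simp
    · rw [compose_of_ne h1] at h
      cases h
  len_unit _ := rfl
  eq_unit := by
    rintro ⟨a, b, p⟩ h
    cases p with
    | nil => exact ⟨a, rfl⟩
    | cons p e => simp at h

end QuiverPath

/-! ### Rational functionals on the path coalgebra -/

namespace PathCoalgebra

open QuiverPath

universe u v w

variable {K : Type u} {V : Type v} [Field K] [Quiver.{w} V]

theorem convMul_basis (d f : WithConv (PathCoalgebra K V →ₗ[K] K)) (r : QuiverPath V) :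
    (d * f).ofConv (basis K V r) =
      ∑ x ∈ r.factorizations, d.ofConv (basis K V x.1) * f.ofConv (basis K V x.2) := by
  rw [LinearMap.convMul_def]
  simp [comul_basis, map_sum]

theorem apply_eq_sum (d : PathCoalgebra K V →ₗ[K] K) (c : PathCoalgebra K V) :
    d c = ((basis K V).repr c).sum fun p a => a * d (basis K V p) := by
  conv_lhs => rw [← (basis K V).linearCombination_repr c]
  simp [Finsupp.linearCombination_apply, Finsupp.sum, map_sum]

theorem exists_functional (d : QuiverPath V → K) :
    ∃ d' : WithConv (PathCoalgebra K V →ₗ[K] K), ∀ p, d'.ofConv (basis K V p) = d p :=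
  ⟨WithConv.toConv ((basis K V).constr K d), fun p => (basis K V).constr_basis K d p⟩

theorem ext_functional {f g : WithConv (PathCoalgebra K V →ₗ[K] K)}
    (h : ∀ p, f.ofConv (basis K V p) = g.ofConv (basis K V p)) : f = g :=
  WithConv.ext ((basis K V).ext h)

theorem mem_leftRationalPart_iff (f : WithConv (PathCoalgebra K V →ₗ[K] K)) :
    f ∈ leftRationalPart K (PathCoalgebra K V) ↔
      (system V).IsRational fun p => f.ofConv (basis K V p) := by
  constructor
  · rintro ⟨n, c, g, h⟩
    refine ⟨n, fun i => (basis K V).repr (c i), fun i p => (g i).ofConv (basis K V p),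
      fun d₀ r => ?_⟩
    obtain ⟨d, hd⟩ := exists_functional d₀
    have := congrArg (fun z => z.ofConv (basis K V r)) (h d)
    simp only [convMul_basis] at this
    simp only [← hd, ← apply_eq_sum]
    refine Eq.trans this ?_
    simp [WithConv.ofConv_sum]
  · rintro ⟨n, c, g, h⟩
    choose g' hg using fun i => exists_functional (g i)
    refine ⟨n, fun i => (basis K V).repr.symm (c i), g', fun d => ext_functional fun r => ?_⟩
    rw [convMul_basis]
    refine (h (fun p => d.ofConv (basis K V p)) r).trans ?_
    simp only [WithConv.ofConv_sum, LinearMap.sum_apply, WithConv.ofConv_smul,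
      LinearMap.smul_apply, smul_eq_mul, hg]
    refine Finset.sum_congr rfl fun i _ => ?_
    rw [apply_eq_sum _ ((basis K V).repr.symm (c i)), LinearEquiv.apply_symm_apply]

theorem mem_rightRationalPart_iff (f : WithConv (PathCoalgebra K V →ₗ[K] K)) :
    f ∈ rightRationalPart K (PathCoalgebra K V) ↔
      (system V).op.IsRational fun p => f.ofConv (basis K V p) := by
  -- Reversing the factorizations turns `d * f` into `f * d`, because scalars commute.
  have hswap (d f : QuiverPath V → K) (r : QuiverPath V) :
      ∑ x ∈ (system V).op.factors r, d x.1 * f x.2 =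
        ∑ x ∈ r.factorizations, f x.1 * d x.2 := by
    simp [PathSystem.op, system, mul_comm]
  constructor
  · rintro ⟨n, c, g, h⟩
    refine ⟨n, fun i => (basis K V).repr (c i), fun i p => (g i).ofConv (basis K V p),
      fun d₀ r => ?_⟩
    obtain ⟨d, hd⟩ := exists_functional d₀
    have := congrArg (fun z => z.ofConv (basis K V r)) (h d)
    simp only [convMul_basis] at this
    refine (hswap d₀ (fun p => f.ofConv (basis K V p)) r).trans ?_
    simp only [← hd, ← apply_eq_sum]
    refine Eq.trans this ?_
    simp [WithConv.ofConv_sum]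
  · rintro ⟨n, c, g, h⟩
    choose g' hg using fun i => exists_functional (g i)
    refine ⟨n, fun i => (basis K V).repr.symm (c i), g', fun d => ext_functional fun r => ?_⟩
    rw [convMul_basis]
    refine ((hswap (fun p => d.ofConv (basis K V p))
      (fun p => f.ofConv (basis K V p)) r).symm.trans (h (fun p => d.ofConv (basis K V p)) r)).trans ?_
    simp only [WithConv.ofConv_sum, LinearMap.sum_apply, WithConv.ofConv_smul,
      LinearMap.smul_apply, smul_eq_mul, hg]
    refine Finset.sum_congr rfl fun i _ => ?_
    rw [apply_eq_sum _ ((basis K V).repr.symm (c i)), LinearEquiv.apply_symm_apply]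

theorem mem_range_toDual_iff (f : WithConv (PathCoalgebra K V →ₗ[K] K)) :
    f ∈ Set.range (QuiverAlgebra.toDual (K := K) (V := V)) ↔
      (Function.support fun p => f.ofConv (basis K V p)).Finite := by
  have key (x : QuiverAlgebra K V) (p : QuiverPath V) :
      (QuiverAlgebra.toDual x).ofConv (basis K V p) = (QuiverAlgebra.basis K V).repr x p := by
    classical
    change (QuiverAlgebra.toDualLinear x).ofConv (basis K V p) = _
    conv_lhs => rw [← (QuiverAlgebra.basis K V).linearCombination_repr x]
    simp only [Finsupp.linearCombination_apply, Finsupp.sum, map_sum, map_smul,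
      WithConv.ofConv_sum, LinearMap.sum_apply, WithConv.ofConv_smul, LinearMap.smul_apply,
      QuiverAlgebra.toDualLinear_basis_apply]
    simp +contextual [eq_comm]
  constructor
  · rintro ⟨x, rfl⟩
    simp only [key]
    exact ((QuiverAlgebra.basis K V).repr x).hasFiniteSupport
  · intro h
    refine ⟨(QuiverAlgebra.basis K V).repr.symm (Finsupp.ofSupportFinite _ h),
      ext_functional fun p => ?_⟩
    rw [key, LinearEquiv.apply_symm_apply]
    rfl

theorem forall_functional_iff {A : (QuiverPath V → K) → Prop} :
    (∀ f : WithConv (PathCoalgebra K V →ₗ[K] K), A fun p => f.ofConv (basis K V p)) ↔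
      ∀ f, A f := by
  refine ⟨fun h f => ?_, fun h f => h _⟩
  obtain ⟨f, hf⟩ := exists_functional f
  simpa only [hf] using h f

variable (K V)

theorem range_toDual_eq_leftRationalPart_iff :
    Set.range (QuiverAlgebra.toDual (K := K) (V := V)) =
        leftRationalPart K (PathCoalgebra K V) ↔
      ∀ v : V, {p : QuiverPath V | p.src = v}.Finite ∧ {p : QuiverPath V | p.tgt = v}.Finite := by
  rw [Set.ext_iff]
  simp only [mem_range_toDual_iff, mem_leftRationalPart_iff]
  rw [forall_functional_iff (A := fun f => f.support.Finite ↔ (system V).IsRational f)]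
  exact PathSystem.finite_support_iff_isRational_iff K (system V)

theorem range_toDual_eq_rightRationalPart_iff :
    Set.range (QuiverAlgebra.toDual (K := K) (V := V)) =
        rightRationalPart K (PathCoalgebra K V) ↔
      ∀ v : V, {p : QuiverPath V | p.src = v}.Finite ∧ {p : QuiverPath V | p.tgt = v}.Finite := by
  rw [Set.ext_iff]
  simp only [mem_range_toDual_iff, mem_rightRationalPart_iff]
  rw [forall_functional_iff (A := fun f => f.support.Finite ↔ (system V).op.IsRational f)]
  exact (PathSystem.finite_support_iff_isRational_iff K (system V).op).trans
    (forall_congr' fun v => and_comm)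

end PathCoalgebra

/-! ### Representations of path systems -/

section Representations

universe k p v t

/-- A locally finite representation of a path system: a vector space with operators `E p`, only
finitely many of which do not vanish on a given `m`, such that `E p ∘ E q` is `E (pq)` or `0` and
such that the operators of the paths of length zero sum to the identity. The vector `E p m` is the
value of `δ m` at `p`. -/
structure PathRep (K : Type k) [Field K] {P : Type p} {V : Type v} (S : PathSystem P V) where
  carrier : Type t
  [addCommGroup : AddCommGroup carrier]
  [module : Module K carrier]
  δ : carrier →ₗ[K] P →₀ carrier
  δ_δ : ∀ m p q, δ (δ m q) p = (S.comp p q).elim 0 (δ m)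
  sum_δ : ∀ m, ((δ m).sum fun p x => if S.len p = 0 then x else 0) = m

attribute [instance] PathRep.addCommGroup PathRep.module

namespace PathRep

variable {K : Type k} [Field K] {P : Type p} {V : Type v} {S : PathSystem P V}

/-- Morphisms of representations: linear maps commuting with all operators. -/
@[ext]
structure Hom (M N : PathRep.{k, p, v, t} K S) where
  toLinearMap : M.carrier →ₗ[K] N.carrier
  comm : ∀ m p, N.δ (toLinearMap m) p = toLinearMap (M.δ m p)

instance : Category (PathRep.{k, p, v, t} K S) where
  Hom M N := Hom M N
  id M := ⟨LinearMap.id, fun _ _ => rfl⟩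
  comp f g := ⟨g.toLinearMap ∘ₗ f.toLinearMap, fun m p => by simp [g.comm, f.comm]⟩

theorem comp_toLinearMap {L M N : PathRep.{k, p, v, t} K S} (f : L ⟶ M) (g : M ⟶ N) :
    (f ≫ g).toLinearMap = g.toLinearMap ∘ₗ f.toLinearMap := rfl

theorem hom_ext {M N : PathRep.{k, p, v, t} K S} {f g : M ⟶ N}
    (h : ∀ m, f.toLinearMap m = g.toLinearMap m) : f = g :=
  Hom.ext (LinearMap.ext h)

/-- The quotient of a representation by the range of a morphism. -/
noncomputable def cokernel {M N : PathRep.{k, p, v, t} K S} (f : M ⟶ N) : PathRep.{k, p, v, t} K S where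
  carrier := N.carrier ⧸ LinearMap.range f.toLinearMap
  δ := (LinearMap.range f.toLinearMap).liftQ
    (Finsupp.mapRange.linearMap (LinearMap.range f.toLinearMap).mkQ ∘ₗ N.δ) (by
      rintro _ ⟨m, rfl⟩
      refine Finsupp.ext fun p => ?_
      simp [f.comm])
  δ_δ m p q := by
    obtain ⟨m, rfl⟩ := Submodule.mkQ_surjective _ m
    simp only [Submodule.mkQ_apply, Submodule.liftQ_apply, LinearMap.comp_apply,
      Finsupp.mapRange.linearMap_apply, Finsupp.mapRange_apply, N.δ_δ]
    cases S.comp p q <;> simp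
  sum_δ m := by
    obtain ⟨m, rfl⟩ := Submodule.mkQ_surjective _ m
    conv_rhs => rw [← N.sum_δ m]
    simp only [Submodule.mkQ_apply, Submodule.liftQ_apply, LinearMap.comp_apply,
      Finsupp.mapRange.linearMap_apply]
    rw [Finsupp.sum_mapRange_index (by simp)]
    simp only [Finsupp.sum, ← Submodule.mkQ_apply, map_sum]
    refine Finset.sum_congr rfl fun p _ => ?_
    split_ifs <;> simp

/-- The projection to the cokernel and the zero map agree after composition with `f`, so the
cokernel vanishes. -/
theorem surjective_of_epi {M N : PathRep.{k, p, v, t} K S} (f : M ⟶ N) [Epi f] :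
    Function.Surjective f.toLinearMap := by
  let π : N ⟶ cokernel f :=
    ⟨(LinearMap.range f.toLinearMap).mkQ, fun m p => rfl⟩
  let z : N ⟶ cokernel f := ⟨0, fun m p => by simp⟩
  have h : π = z := by
    rw [← cancel_epi f]
    refine hom_ext fun m => ?_
    change (LinearMap.range f.toLinearMap).mkQ (f.toLinearMap m) = 0
    simp
  intro n
  have hn : (LinearMap.range f.toLinearMap).mkQ n = 0 :=
    congrArg (fun g : N ⟶ cokernel f => g.toLinearMap n) h
  simpa using hn

theorem epi_of_surjective {M N : PathRep.{k, p, v, t} K S} (f : M ⟶ N)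
    (hf : Function.Surjective f.toLinearMap) : Epi f where
  left_cancellation g h hgh := by
    refine hom_ext fun n => ?_
    obtain ⟨m, rfl⟩ := hf n
    exact congrArg (fun g => g.toLinearMap m) hgh

end PathRep

/-- A partial action of a path system on a set `B`, in which every element of `B` is fixed by
exactly one path of length zero and is acted on by finitely many paths only. -/
structure PathAction {P : Type p} {V : Type v} (S : PathSystem P V) (B : Type t) where
  act : P → B → Option B
  act_act : ∀ p q b, (act q b).bind (act p) = (S.comp p q).bind fun r => act r b
  unit_act : ∀ b, ∃ u, S.len u = 0 ∧ act u b = some b ∧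
    ∀ q, S.len q = 0 → q ≠ u → act q b = none
  finite : ∀ b, {q | act q b ≠ none}.Finite

namespace PathAction

variable (K : Type k) [Field K] {P : Type p} {V : Type v} {S : PathSystem P V}
  {B : Type t} (A : PathAction S B)

theorem finite_support (b : B) :
    (Function.support fun q => (A.act q b).elim 0 fun b' => Finsupp.single b' (1 : K)).Finite :=
  (A.finite b).subset fun q hq h => hq (by simp [h])

/-- The operators of the representation with basis `B`. -/
noncomputable def coeff : (B →₀ K) →ₗ[K] P →₀ (B →₀ K) :=
  Finsupp.linearCombination K fun b => Finsupp.ofSupportFinite _ (A.finite_support K b)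

theorem coeff_single (b : B) (c : K) (q : P) :
    A.coeff K (Finsupp.single b c) q =
      c • (A.act q b).elim 0 fun b' => Finsupp.single b' (1 : K) := by
  simp [coeff, Finsupp.linearCombination_single, Finsupp.ofSupportFinite_coe]

/-- The representation with basis `B` on which paths act by a partial action. -/
noncomputable def rep : PathRep.{k, p, v, max k t} K S where
  carrier := B →₀ K
  δ := A.coeff K
  δ_δ m p q := by
    induction m using Finsupp.induction_linear with
    | zero => cases S.comp p q <;> simp
    | add x y hx hy =>
      rw [map_add, Finsupp.add_apply, map_add, Finsupp.add_apply, hx, hy]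
      cases S.comp p q <;> simp
    | single b c =>
      have h := A.act_act p q b
      rw [coeff_single, map_smul, Finsupp.smul_apply]
      cases hq : A.act q b with
      | none =>
        rw [hq] at h
        cases hc : S.comp p q with
        | none => simp
        | some r =>
          simp only [hc, Option.bind_none, Option.bind_some] at h
          simp [coeff_single, ← h]
      | some b' =>
        rw [hq] at h
        cases hc : S.comp p q with
        | none =>
          simp only [hc, Option.bind_none, Option.bind_some] at h
          simp [coeff_single, h]
        | some r =>
          simp only [hc, Option.bind_some] at h
          simp [coeff_single, h]
  sum_δ m := by
    induction m using Finsupp.induction_linear with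
    | zero => simp
    | add x y hx hy =>
      rw [map_add, Finsupp.sum_add_index', hx, hy]
      · simp
      · intro p x y
        split_ifs <;> simp
    | single b c =>
      obtain ⟨u, hu, hb, hne⟩ := A.unit_act b
      rw [Finsupp.sum, Finset.sum_eq_single u]
      · simp [hu, coeff_single, hb]
      · intro q _ hq
        split_ifs with h0
        · simp [coeff_single, hne q h0 hq]
        · rfl
      · intro h
        simpa [hu] using h

/-- The basis vectors of the representation with basis `B`. -/
noncomputable def single (b : B) : (A.rep K).carrier := (Finsupp.single b 1 : B →₀ K)

theorem single_ne_zero (b : B) : A.single K b ≠ 0 :=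
  fun h => one_ne_zero (Finsupp.single_eq_zero.1 h)

theorem δ_single (b : B) (q : P) :
    (A.rep K).δ (A.single K b) q = (A.act q b).elim 0 (A.single K) :=
  (A.coeff_single K b 1 q).trans (one_smul _ _)

variable {K}

theorem linearMap_ext {M : Type*} [AddCommGroup M] [Module K M] {f g : (A.rep K).carrier →ₗ[K] M}
    (h : ∀ b, f (A.single K b) = g (A.single K b)) : f = g :=
  Finsupp.lhom_ext' fun b => LinearMap.ext_ring (h b)

/-- The linear map given by its values on the basis. -/
noncomputable def lift {M : Type*} [AddCommGroup M] [Module K M] (f : B → M) :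
    (A.rep K).carrier →ₗ[K] M :=
  Finsupp.linearCombination K f

theorem lift_single {M : Type*} [AddCommGroup M] [Module K M] (f : B → M) (b : B) :
    A.lift f (A.single K b) = f b := by
  refine (Finsupp.linearCombination_single K (1 : K) b).trans (one_smul _ _)

/-- The morphism of representations given by its values on the basis. -/
noncomputable def desc {M : PathRep.{k, p, v, max k t} K S} (f : B → M.carrier)
    (hf : ∀ q b, M.δ (f b) q = (A.act q b).elim 0 f) : A.rep K ⟶ M where
  toLinearMap := A.lift f
  comm m q := by
    have : Finsupp.lapply q ∘ₗ M.δ ∘ₗ A.lift f = A.lift f ∘ₗ Finsupp.lapply q ∘ₗ (A.rep K).δ := by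
      refine A.linearMap_ext fun b => ?_
      simp only [LinearMap.comp_apply, Finsupp.lapply_apply, lift_single, δ_single, hf]
      cases A.act q b <;> simp [lift_single]
    exact LinearMap.congr_fun this m

theorem desc_single {M : PathRep.{k, p, v, max k t} K S} (f : B → M.carrier)
    (hf : ∀ q b, M.δ (f b) q = (A.act q b).elim 0 f) (b : B) :
    (A.desc f hf).toLinearMap (A.single K b) = f b :=
  A.lift_single f b

theorem hom_ext {M : PathRep.{k, p, v, max k t} K S} {f g : A.rep K ⟶ M}
    (h : ∀ b, f.toLinearMap (A.single K b) = g.toLinearMap (A.single K b)) : f = g :=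
  PathRep.Hom.ext (A.linearMap_ext h)

end PathAction

namespace PathSystem

variable {P : Type p} {V : Type v} (S : PathSystem P V)

/-- Copies, indexed by `X`, of the left multiplication of paths on paths. -/
def freeAction (h : ∀ v, {p | S.tgt p = v}.Finite) (X : Type t) : PathAction S (X × P) where
  act q b := (S.comp q b.2).map (Prod.mk b.1)
  act_act p q b := by
    have := congrArg (Option.map (Prod.mk b.1)) (S.comp_assoc p q b.2)
    simp only [Option.map_bind] at this
    simpa [Option.bind_map, Function.comp_def] using this.symm
  unit_act b := by
    refine ⟨S.unit (S.src b.2), S.len_unit _, by simp [S.unit_comp], fun q hq hne => ?_⟩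
    cases hc : S.comp q b.2 with
    | none => rfl
    | some r => exact absurd (eq_of_unit_comp hq hc).1 hne
  finite b := by
    refine (h (S.src b.2)).subset fun q hq => ?_
    by_contra hne
    exact hq (by simp [S.comp_eq_none hne])

open Classical in
/-- The action of paths by left multiplication on a finite set of paths closed under passing to
final pieces. -/
noncomputable def segmentAction (F : Set P) (hF : F.Finite)
    (hcl : ∀ {q s r}, S.comp q s = some r → r ∈ F → s ∈ F) : PathAction S F where
  act q s := (S.comp q s.1).bind fun r => if h : r ∈ F then some ⟨r, h⟩ else none
  act_act p q b := by
    have h := S.comp_assoc p q b.1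
    have h2 : (S.comp p q).bind (fun r => (S.comp r b.1).bind
        fun r => if h : r ∈ F then some (⟨r, h⟩ : F) else none) =
        ((S.comp q b.1).bind (S.comp p)).bind
          fun r => if h : r ∈ F then some (⟨r, h⟩ : F) else none := by
      rw [← h, Option.bind_assoc]
    rw [h2]
    cases hq : S.comp q b.1 with
    | none => rfl
    | some r =>
      by_cases hr : r ∈ F
      · simp [hr]
      · cases hp : S.comp p r with
        | none => simp [hr, hp]
        | some r' =>
          -- A product that has left `F` cannot return, as `F` contains the final pieces of its
          -- members. Truncating after each factor is therefore the same as truncating once.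
          have : r' ∉ F := fun h' => hr (hcl hp h')
          simp [hr, hp, this]
  unit_act b := by
    refine ⟨S.unit (S.src b.1), S.len_unit _, by simp [S.unit_comp], fun q hq hne => ?_⟩
    cases hc : S.comp q b.1 with
    | none => rfl
    | some r => exact absurd (eq_of_unit_comp hq hc).1 hne
  finite b := by
    refine (hF.biUnion fun r _ => ((S.factors r).image Prod.fst).finite_toSet).subset ?_
    intro q hq
    cases hc : S.comp q b.1 with
    | none => simp [hc] at hq
    | some r =>
      by_cases hr : r ∈ F
      · refine Set.mem_biUnion hr ?_
        simp only [Finset.coe_image, Set.mem_image, Finset.mem_coe]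
        exact ⟨(q, b.1), S.mem_factors.2 hc, rfl⟩
      · simp [hc, hr] at hq

end PathSystem

/-! ### Projective representations and finiteness of paths -/

namespace PathRep

variable {K : Type k} [Field K] {P : Type p} {V : Type v} {S : PathSystem P V}

/-- The morphism from a free representation determined by the images of the paths of length
zero. -/
noncomputable def freeDesc (h : ∀ v, {p | S.tgt p = v}.Finite) {X : Type (max k p)}
    {M : PathRep.{k, p, v, max k p} K S} (f : X → V → M.carrier) :
    (S.freeAction h X).rep K ⟶ M :=
  (S.freeAction h X).desc (fun b => M.δ (f b.1 (S.tgt b.2)) b.2) (by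
    intro q b
    rw [M.δ_δ]
    change _ = ((S.comp q b.2).map _).elim _ _
    cases hc : S.comp q b.2 with
    | none => rfl
    | some r => simp [S.tgt_comp hc])

theorem freeDesc_single (h : ∀ v, {p | S.tgt p = v}.Finite) {X : Type (max k p)}
    {M : PathRep.{k, p, v, max k p} K S} (f : X → V → M.carrier) (x : X) (p : P) :
    (freeDesc h f).toLinearMap ((S.freeAction h X).single K (x, p)) = M.δ (f x (S.tgt p)) p :=
  (S.freeAction h X).desc_single _ _ _

/-- The basis vector of `p` is obtained by letting `p` act on the trivial path at its target, so
morphisms out of a free representation are determined on trivial paths. -/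
theorem apply_single_free (h : ∀ v, {p | S.tgt p = v}.Finite) {X : Type (max k p)}
    {M : PathRep.{k, p, v, max k p} K S} (f : (S.freeAction h X).rep K ⟶ M) (x : X) (p : P) :
    f.toLinearMap ((S.freeAction h X).single K (x, p)) =
      M.δ (f.toLinearMap ((S.freeAction h X).single K (x, S.unit (S.tgt p)))) p := by
  have hact : (S.freeAction h X).act p (x, S.unit (S.tgt p)) = some (x, p) := by
    simp [PathSystem.freeAction, S.comp_unit]
  rw [f.comm, PathAction.δ_single, hact]
  rfl

/-- It suffices to lift the images of the trivial paths. An arbitrary preimage will do: `freeDesc`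
applies the operator of a path ending at `v`, which sees only the component at `v`. -/
theorem projective_free (h : ∀ v, {p | S.tgt p = v}.Finite) (X : Type (max k p)) :
    Projective ((S.freeAction h X).rep K) where
  factors {N M} f e _ := by
    choose σ hσ using surjective_of_epi e
    refine ⟨freeDesc h fun x v =>
      σ (f.toLinearMap ((S.freeAction h X).single K (x, S.unit v))), ?_⟩
    refine PathAction.hom_ext _ ?_
    rintro ⟨x, p⟩
    rw [comp_toLinearMap, LinearMap.comp_apply, freeDesc_single, ← e.comm, hσ,
      ← apply_single_free]

theorem enoughProjectives_of_finite (h : ∀ v, {p | S.tgt p = v}.Finite) :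
    EnoughProjectives (PathRep.{k, p, v, max k p} K S) where
  presentation M := by
    have hp := projective_free (K := K) h M.carrier
    let f : (S.freeAction h M.carrier).rep K ⟶ M := freeDesc h fun m _ => m
    have hf : Epi f := epi_of_surjective f fun m => ?_
    · exact ⟨{ p := (S.freeAction h M.carrier).rep K, f := f }⟩
    -- The vector `m` is the sum of its components at trivial paths, and each is hit by that trivial
    -- path in the copy indexed by `m`.
    refine ⟨(M.δ m).sum fun p _ =>
      if S.len p = 0 then (S.freeAction h M.carrier).single K (m, p) else 0, ?_⟩
    conv_rhs => rw [← M.sum_δ m]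
    simp only [Finsupp.sum, map_sum]
    refine Finset.sum_congr rfl fun p _ => ?_
    split_ifs
    · exact freeDesc_single h _ m p
    · simp

theorem finite_of_enoughProjectives (h : EnoughProjectives (PathRep.{k, p, v, max k p} K S))
    (v : V) : {p | S.tgt p = v}.Finite := by
  classical
  -- The simple representation at `v`.
  let A₁ := S.segmentAction {S.unit v} (Set.finite_singleton _) (by
    intro q s r hc hr
    rw [Set.mem_singleton_iff] at hr ⊢
    subst hr
    have hl := S.len_comp hc
    rw [S.len_unit] at hl
    exact (PathSystem.eq_of_unit_comp (by lia) hc).2.symm)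
  let u₁ : ({S.unit v} : Set P) := ⟨S.unit v, rfl⟩
  obtain ⟨⟨Q, π, _, _⟩⟩ := h.presentation (A₁.rep K)
  obtain ⟨x, hx⟩ := surjective_of_epi π (A₁.single K u₁)
  -- It remains to refute `E_p x = 0` for a path `p` ending at `v`.
  refine (Q.δ x).hasFiniteSupport.subset ?_
  rintro p rfl hp
  let F : Set P := {s | ∃ q, S.comp q s = some p}
  let A := S.segmentAction F
    (((S.factors p).image Prod.snd).finite_toSet.subset (by
      rintro s ⟨q, hq⟩
      simp only [Finset.coe_image, Set.mem_image, Finset.mem_coe]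
      exact ⟨(q, s), S.mem_factors.2 hq, rfl⟩))
    (by
      rintro q s r hc ⟨q', hq'⟩
      have := S.comp_assoc q' q s
      rw [hc, Option.bind_some, hq', Option.bind_eq_some_iff] at this
      obtain ⟨a, -, ha⟩ := this
      exact ⟨a, ha⟩)
  let u : F := ⟨S.unit (S.tgt p), p, S.comp_unit p⟩
  -- The quotient map onto the simple top, killing every final piece of positive length.
  let f : F → (A₁.rep K).carrier := fun s => if s = u then A₁.single K u₁ else 0
  have hact₁ (q : P) : A₁.act q u₁ = if q = S.unit (S.tgt p) then some u₁ else none := by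
    change (S.comp q (S.unit (S.tgt p))).bind (fun r => if h : r ∈ _ then _ else _) = _
    cases hc : S.comp q (S.unit (S.tgt p)) with
    | none =>
      rw [if_neg]
      · rfl
      · rintro rfl
        have := S.unit_comp (S.unit (S.tgt p))
        rw [S.src_unit, hc] at this
        cases this
    | some r =>
      obtain ⟨-, rfl⟩ := PathSystem.eq_of_comp_unit (S.len_unit _) hc
      by_cases hr : r = S.unit (S.tgt p)
      · simp [hr, u₁]
      · simp [hr]
  have hact (q : P) (s : F) : (A.act q s).elim 0 f =
      if s = u ∧ q = S.unit (S.tgt p) then A₁.single K u₁ else 0 := by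
    change ((S.comp q s.1).bind (fun r => if h : r ∈ F then some ⟨r, h⟩ else none)).elim 0 f = _
    cases hc : S.comp q s.1 with
    | none =>
      rw [if_neg]
      · rfl
      · rintro ⟨rfl, rfl⟩
        have := S.unit_comp (S.unit (S.tgt p))
        rw [S.src_unit, hc] at this
        cases this
    | some r =>
      -- Lengths add, so a product is trivial only if both factors are.
      have hr : r = S.unit (S.tgt p) ↔ s = u ∧ q = S.unit (S.tgt p) := by
        constructor
        · rintro rfl
          have hlen := S.len_comp hc
          rw [S.len_unit] at hlen
          exact ⟨Subtype.ext (PathSystem.eq_of_unit_comp (by lia) hc).2.symm,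
            (PathSystem.eq_of_comp_unit (by lia) hc).2.symm⟩
        · rintro ⟨rfl, rfl⟩
          exact (PathSystem.eq_of_unit_comp (S.len_unit _) hc).2
      by_cases hF : r ∈ F
      · simp only [Option.bind_some, dif_pos hF, Option.elim_some, f, ← hr]
        simp only [u, Subtype.mk.injEq]
      · rw [if_neg fun h => hF (hr.2 h ▸ u.2)]
        simp [hF]
  have hf (q : P) (s : F) : (A₁.rep K).δ (f s) q = (A.act q s).elim 0 f := by
    rw [hact]
    by_cases hs : s = u
    · simp only [f, hs, if_true, true_and, PathAction.δ_single, hact₁]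
      split_ifs <;> rfl
    · simp [f, hs]
  let e : A.rep K ⟶ A₁.rep K := A.desc f hf
  have he : Epi e := epi_of_surjective e (by
    intro y
    let g : (A₁.rep K).carrier →ₗ[K] (A.rep K).carrier := A₁.lift fun _ => A.single K u
    have : e.toLinearMap ∘ₗ g = LinearMap.id := by
      refine A₁.linearMap_ext fun b => ?_
      rw [LinearMap.comp_apply, A₁.lift_single, A.desc_single, show f u = A₁.single K u₁ from if_pos rfl,
        LinearMap.id_apply]
      congr 1
      exact (Subsingleton.elim _ _)
    exact ⟨g y, LinearMap.congr_fun this y⟩)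
  let l := Projective.factorThru π e
  have hl : e.toLinearMap (l.toLinearMap x) = A₁.single K u₁ := by
    rw [← hx]
    exact congrArg (fun g => g.toLinearMap x) (Projective.factorThru_comp π e)
  let w : (A.rep K).carrier →ₗ[K] K := A.lift fun s => if s = u then 1 else 0
  have hw : e.toLinearMap = w.smulRight (A₁.single K u₁) := by
    refine A.linearMap_ext fun s => ?_
    rw [A.desc_single, LinearMap.smulRight_apply, A.lift_single]
    simp [f]
  let pF : F := ⟨p, S.unit (S.src p), S.unit_comp p⟩
  have hactp (s : F) : A.act p s = if s = u then some pF else none := by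
    change (S.comp p s.1).bind (fun r => if h : r ∈ F then some (⟨r, h⟩ : F) else none) = _
    by_cases hs : s = u
    · rw [if_pos hs, hs, S.comp_unit, Option.bind_some, dif_pos pF.2]
    · rw [if_neg hs]
      cases hc : S.comp p s.1 with
      | none => rfl
      | some r =>
        rw [Option.bind_some, dif_neg]
        rintro ⟨q, hq⟩
        have h1 := S.len_comp hc
        have h2 := S.len_comp hq
        exact hs (Subtype.ext (PathSystem.eq_of_comp_unit (by lia) hc).1)
  -- Only the trivial piece survives `E_p`: if `ps` is still a final piece of `p`, then `s` has
  -- length zero. Thus `e` and `E_p` both read off the same coefficient `w`.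
  have hw' : Finsupp.lapply p ∘ₗ (A.rep K).δ = w.smulRight (A.single K pF) := by
    refine A.linearMap_ext fun s => ?_
    rw [LinearMap.smulRight_apply, A.lift_single, LinearMap.comp_apply, Finsupp.lapply_apply,
      A.δ_single K, hactp]
    split_ifs <;> simp
  -- From `E_p x = 0` the coefficient `w` of the lift of `x` vanishes, although `e` sends this lift
  -- to the nonzero generator.
  have h0 : w (l.toLinearMap x) • A.single K pF = 0 := by
    rw [← LinearMap.smulRight_apply, ← hw', LinearMap.comp_apply, Finsupp.lapply_apply, l.comm, hp,
      map_zero]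
  rw [hw, LinearMap.smulRight_apply, (smul_eq_zero.1 h0).resolve_right (A.single_ne_zero K pF),
    zero_smul] at hl
  exact A₁.single_ne_zero K u₁ hl.symm

theorem enoughProjectives_iff :
    EnoughProjectives (PathRep.{k, p, v, max k p} K S) ↔ ∀ v, {p | S.tgt p = v}.Finite :=
  ⟨finite_of_enoughProjectives, enoughProjectives_of_finite⟩

end PathRep

end Representations

/-! ### Comodules over the path coalgebra -/

namespace PathCoalgebra

open QuiverPath TensorProduct

universe u v w t

variable {K : Type u} {V : Type v} [Field K] [Quiver.{w} V]

/-- A tensor `p ⊗ q` occurs in the comultiplication of a path only if that path is `pq`, and then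
exactly once. -/
theorem repr_comul (c : PathCoalgebra K V) (p q : QuiverPath V) :
    ((basis K V).tensorProduct (basis K V)).repr (Coalgebra.comul (R := K) c) (p, q) =
      (compose p q).elim 0 ((basis K V).repr c) := by
  classical
  have h (s : QuiverPath V) :
      ((basis K V).tensorProduct (basis K V)).repr (Coalgebra.comul (R := K) (basis K V s)) (p, q) =
        if compose p q = some s then 1 else 0 := by
    rw [comul_basis, map_sum, Finsupp.finsetSum_apply]
    have (x : QuiverPath V × QuiverPath V) :
        ((basis K V).tensorProduct (basis K V)).repr (basis K V x.1 ⊗ₜ[K] basis K V x.2) (p, q) =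
          if x = (p, q) then 1 else 0 := by
      rw [Module.Basis.tensorProduct_repr_tmul_apply]
      simp [Finsupp.single_apply, Prod.ext_iff, ← ite_and]
    simp only [this, Finset.sum_ite_eq', mem_factorizations]
  cases hc : compose p q with
  | none =>
    have : Finsupp.lapply (p, q) ∘ₗ
        ((basis K V).tensorProduct (basis K V)).repr.toLinearMap ∘ₗ
          Coalgebra.comul (R := K) (A := PathCoalgebra K V) = 0 := by
      refine (basis K V).ext fun s => (h s).trans ?_
      simp [hc]
    exact LinearMap.congr_fun this c
  | some r =>
    have : Finsupp.lapply (p, q) ∘ₗ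
        ((basis K V).tensorProduct (basis K V)).repr.toLinearMap ∘ₗ
          Coalgebra.comul (R := K) (A := PathCoalgebra K V) = (basis K V).coord r := by
      refine (basis K V).ext fun s => (h s).trans ?_
      simp [hc, Finsupp.single_apply, eq_comm]
    exact LinearMap.congr_fun this c

/-! ### Right comodules in coordinates -/

section Right

variable {M N : Type*} [AddCommGroup M] [Module K M] [AddCommGroup N] [Module K N]

open Classical in
/-- The coefficients at the paths of an element of `M ⊗ KΓ`. -/
noncomputable def rightCoeff : M ⊗[K] PathCoalgebra K V ≃ₗ[K] QuiverPath V →₀ M :=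
  equivFinsuppOfBasisRight (basis K V)

theorem rightCoeff_tmul (m : M) (c : PathCoalgebra K V) (p : QuiverPath V) :
    rightCoeff (m ⊗ₜ[K] c) p = (basis K V).repr c p • m := by
  classical exact equivFinsuppOfBasisRight_apply_tmul_apply _ _ _ _

theorem rightCoeff_symm_apply (f : QuiverPath V →₀ M) :
    (rightCoeff (K := K)).symm f = f.sum fun p m => m ⊗ₜ[K] basis K V p := by
  classical exact equivFinsuppOfBasisRight_symm_apply _ _

theorem rightCoeff_rTensor (f : M →ₗ[K] N) (x : M ⊗[K] PathCoalgebra K V) (p : QuiverPath V) :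
    rightCoeff (f.rTensor _ x) p = f (rightCoeff x p) := by
  induction x with
  | zero => simp
  | add x y hx hy => simp [hx, hy]
  | tmul m c => simp [rightCoeff_tmul]

theorem rightCoeff_comm_iff (f : M →ₗ[K] N) (ρ : M →ₗ[K] M ⊗[K] PathCoalgebra K V)
    (σ : N →ₗ[K] N ⊗[K] PathCoalgebra K V) :
    σ ∘ₗ f = f.rTensor _ ∘ₗ ρ ↔
      ∀ m p, rightCoeff (σ (f m)) p = f (rightCoeff (ρ m) p) := by
  rw [LinearMap.ext_iff]
  refine forall_congr' fun m => ?_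
  rw [← (rightCoeff (K := K)).injective.eq_iff, Finsupp.ext_iff]
  simp [rightCoeff_rTensor]

/-- Coefficients at `p ⊗ q` are compared: applying `ρ` twice gives `E_p E_q`, while comultiplying
gives `E_{pq}` by `repr_comul`. -/
theorem rightCoeff_coassoc_iff (ρ : M →ₗ[K] M ⊗[K] PathCoalgebra K V) :
    (TensorProduct.assoc K M _ _).toLinearMap ∘ₗ ρ.rTensor _ ∘ₗ ρ =
        (Coalgebra.comul (R := K) (A := PathCoalgebra K V)).lTensor M ∘ₗ ρ ↔
      ∀ m p q, rightCoeff (ρ (rightCoeff (ρ m) q)) p =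
        (compose p q).elim 0 (rightCoeff (ρ m)) := by
  classical
  let e₂ : M ⊗[K] (PathCoalgebra K V ⊗[K] PathCoalgebra K V) ≃ₗ[K] _ :=
    equivFinsuppOfBasisRight (M := M) ((basis K V).tensorProduct (basis K V))
  have h1 (x : M ⊗[K] PathCoalgebra K V) (p q : QuiverPath V) :
      e₂ (TensorProduct.assoc K M _ _ (ρ.rTensor _ x)) (p, q) =
        rightCoeff (ρ (rightCoeff x q)) p := by
    induction x with
    | zero => simp
    | add x y hx hy => simp [hx, hy]
    | tmul m c =>
      rw [LinearMap.rTensor_tmul, rightCoeff_tmul]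
      simp only [map_smul, Finsupp.smul_apply]
      induction ρ m with
      | zero => simp
      | add x y hx hy => simp [add_tmul, hx, hy]
      | tmul m d =>
        rw [TensorProduct.assoc_tmul, rightCoeff_tmul]
        refine (equivFinsuppOfBasisRight_apply_tmul_apply _ _ _ _).trans ?_
        rw [Module.Basis.tensorProduct_repr_tmul_apply, smul_smul, smul_eq_mul]
  have h2 (x : M ⊗[K] PathCoalgebra K V) (p q : QuiverPath V) :
      e₂ ((Coalgebra.comul (R := K) (A := PathCoalgebra K V)).lTensor M x) (p, q) =
        (compose p q).elim 0 (rightCoeff x) := by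
    induction x with
    | zero => cases compose p q <;> simp
    | add x y hx hy =>
      rw [map_add, map_add, Finsupp.add_apply, hx, hy]
      cases compose p q <;> simp
    | tmul m c =>
      rw [LinearMap.lTensor_tmul]
      refine (equivFinsuppOfBasisRight_apply_tmul_apply _ _ _ _).trans ?_
      rw [repr_comul]
      cases compose p q <;> simp [rightCoeff_tmul]
  rw [LinearMap.ext_iff]
  refine forall_congr' fun m => ?_
  rw [← e₂.injective.eq_iff, Finsupp.ext_iff, Prod.forall]
  simp only [LinearMap.comp_apply, LinearEquiv.coe_coe, h1, h2]

theorem rightCoeff_counit_iff (ρ : M →ₗ[K] M ⊗[K] PathCoalgebra K V) :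
    (Coalgebra.counit (R := K) (A := PathCoalgebra K V)).lTensor M ∘ₗ ρ =
        (TensorProduct.mk K M K).flip 1 ↔
      ∀ m, ((rightCoeff (ρ m)).sum fun p x => if p.path.length = 0 then x else 0) = m := by
  have h (x : M ⊗[K] PathCoalgebra K V) :
      TensorProduct.rid K M ((Coalgebra.counit (R := K) (A := PathCoalgebra K V)).lTensor M x) =
        (rightCoeff x).sum fun p x => if p.path.length = 0 then x else 0 := by
    obtain ⟨f, rfl⟩ := (rightCoeff (K := K)).symm.surjective x
    rw [LinearEquiv.apply_symm_apply, rightCoeff_symm_apply]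
    simp [Finsupp.sum, counit_basis]
  rw [LinearMap.ext_iff]
  refine forall_congr' fun m => ?_
  rw [← (TensorProduct.rid K M).injective.eq_iff]
  simp [h]

end Right

/-! ### Left comodules in coordinates -/

section Left

variable {M N : Type*} [AddCommGroup M] [Module K M] [AddCommGroup N] [Module K N]

open Classical in
/-- The coefficients at the paths of an element of `KΓ ⊗ M`. -/
noncomputable def leftCoeff : PathCoalgebra K V ⊗[K] M ≃ₗ[K] QuiverPath V →₀ M :=
  equivFinsuppOfBasisLeft (basis K V)

theorem leftCoeff_tmul (m : M) (c : PathCoalgebra K V) (p : QuiverPath V) :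
    leftCoeff (c ⊗ₜ[K] m) p = (basis K V).repr c p • m := by
  classical exact equivFinsuppOfBasisLeft_apply_tmul_apply _ _ _ _

theorem leftCoeff_symm_apply (f : QuiverPath V →₀ M) :
    (leftCoeff (K := K)).symm f = f.sum fun p m => basis K V p ⊗ₜ[K] m := by
  classical exact equivFinsuppOfBasisLeft_symm_apply _ _

theorem leftCoeff_lTensor (f : M →ₗ[K] N) (x : PathCoalgebra K V ⊗[K] M) (p : QuiverPath V) :
    leftCoeff (f.lTensor _ x) p = f (leftCoeff x p) := by
  induction x with
  | zero => simp
  | add x y hx hy => simp [hx, hy]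
  | tmul c m => simp [leftCoeff_tmul]

theorem leftCoeff_comm_iff (f : M →ₗ[K] N) (ρ : M →ₗ[K] PathCoalgebra K V ⊗[K] M)
    (σ : N →ₗ[K] PathCoalgebra K V ⊗[K] N) :
    σ ∘ₗ f = f.lTensor _ ∘ₗ ρ ↔
      ∀ m p, leftCoeff (σ (f m)) p = f (leftCoeff (ρ m) p) := by
  rw [LinearMap.ext_iff]
  refine forall_congr' fun m => ?_
  rw [← (leftCoeff (K := K)).injective.eq_iff, Finsupp.ext_iff]
  simp [leftCoeff_lTensor]

/-- The first coaction contributes the outer tensor factor `q` and the second the inner factor `p`.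
The composite is thus governed by `qp`, which is composition in the opposite path system. -/
theorem leftCoeff_coassoc_iff (ρ : M →ₗ[K] PathCoalgebra K V ⊗[K] M) :
    (TensorProduct.assoc K _ _ M).toLinearMap ∘ₗ
          (Coalgebra.comul (R := K) (A := PathCoalgebra K V)).rTensor M ∘ₗ ρ =
        ρ.lTensor _ ∘ₗ ρ ↔
      ∀ m p q, leftCoeff (ρ (leftCoeff (ρ m) q)) p =
        (compose q p).elim 0 (leftCoeff (ρ m)) := by
  have h1 (x : (PathCoalgebra K V ⊗[K] PathCoalgebra K V) ⊗[K] M) (p q : QuiverPath V) :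
      leftCoeff (leftCoeff (TensorProduct.assoc K _ _ M x) q) p =
        TensorProduct.lid K M ((Finsupp.lapply (q, p) ∘ₗ
          ((basis K V).tensorProduct (basis K V)).repr.toLinearMap).rTensor M x) := by
    induction x with
    | zero => simp
    | add x y hx hy => simp [hx, hy]
    | tmul z m =>
      induction z with
      | zero => simp
      | add x y hx hy => simp only [add_tmul, map_add, Finsupp.add_apply, hx, hy]
      | tmul c d =>
        rw [TensorProduct.assoc_tmul, leftCoeff_tmul, map_smul, Finsupp.smul_apply, leftCoeff_tmul,
          smul_smul, LinearMap.rTensor_tmul, TensorProduct.lid_tmul]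
        congr 1
        change _ = ((basis K V).tensorProduct (basis K V)).repr (c ⊗ₜ[K] d) (q, p)
        rw [Module.Basis.tensorProduct_repr_tmul_apply, smul_eq_mul, mul_comm]
  have h2 (x : PathCoalgebra K V ⊗[K] M) (p q : QuiverPath V) :
      leftCoeff (leftCoeff (TensorProduct.assoc K _ _ M
        ((Coalgebra.comul (R := K) (A := PathCoalgebra K V)).rTensor M x)) q) p =
        (compose q p).elim 0 (leftCoeff x) := by
    rw [h1]
    induction x with
    | zero => cases compose q p <;> simp
    | add x y hx hy =>
      rw [map_add, map_add, map_add, hx, hy]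
      cases compose q p <;> simp
    | tmul c m =>
      rw [LinearMap.rTensor_tmul, LinearMap.rTensor_tmul, TensorProduct.lid_tmul]
      refine (congrArg (· • m) (repr_comul c q p)).trans ?_
      cases compose q p <;> simp [leftCoeff_tmul]
  rw [LinearMap.ext_iff]
  refine forall_congr' fun m => ?_
  rw [← (leftCoeff (K := K) (V := V) (M := PathCoalgebra K V ⊗[K] M)).injective.eq_iff,
    Finsupp.ext_iff, forall_comm]
  refine forall_congr' fun q => ?_
  rw [← (leftCoeff (K := K) (V := V) (M := M)).injective.eq_iff, Finsupp.ext_iff]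
  refine forall_congr' fun p => ?_
  simp only [LinearMap.comp_apply, LinearEquiv.coe_coe, h2, leftCoeff_lTensor]
  exact eq_comm

theorem leftCoeff_counit_iff (ρ : M →ₗ[K] PathCoalgebra K V ⊗[K] M) :
    (Coalgebra.counit (R := K) (A := PathCoalgebra K V)).rTensor M ∘ₗ ρ =
        TensorProduct.mk K K M 1 ↔
      ∀ m, ((leftCoeff (ρ m)).sum fun p x => if p.path.length = 0 then x else 0) = m := by
  have h (x : PathCoalgebra K V ⊗[K] M) :
      TensorProduct.lid K M ((Coalgebra.counit (R := K) (A := PathCoalgebra K V)).rTensor M x) =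
        (leftCoeff x).sum fun p x => if p.path.length = 0 then x else 0 := by
    obtain ⟨f, rfl⟩ := (leftCoeff (K := K)).symm.surjective x
    rw [LinearEquiv.apply_symm_apply, leftCoeff_symm_apply]
    simp [Finsupp.sum, counit_basis]
  rw [LinearMap.ext_iff]
  refine forall_congr' fun m => ?_
  rw [← (TensorProduct.lid K M).injective.eq_iff]
  simp [h]

end Left

/-! ### Comodules as representations, and semiperfectness -/

variable (K V)

/-- The functor sending a right comodule over the path coalgebra to the associated representation
of the paths. -/
noncomputable def rightFunctor : RightComodule.{u, max u v w, t} K (PathCoalgebra K V) ⥤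
    PathRep.{u, max v w, v, t} K (system V) where
  obj M :=
    { carrier := M.carrier
      δ := rightCoeff.toLinearMap ∘ₗ M.coact
      δ_δ := (rightCoeff_coassoc_iff M.coact).1 M.coassoc
      sum_δ := (rightCoeff_counit_iff M.coact).1 M.lTensor_counit_comp_coact }
  map f := ⟨f.toLinearMap, (rightCoeff_comm_iff _ _ _).1 f.comm⟩

instance : (rightFunctor.{u, v, w, t} K V).Faithful where
  map_injective h := RightComodule.Hom.ext (congrArg PathRep.Hom.toLinearMap h)

instance : (rightFunctor.{u, v, w, t} K V).Full where
  map_surjective f := ⟨⟨f.toLinearMap, (rightCoeff_comm_iff _ _ _).2 f.comm⟩, rfl⟩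

instance : (rightFunctor.{u, v, w, t} K V).EssSurj where
  mem_essImage N := by
    -- The carrier is unchanged, so the identity map serves as the isomorphism in both directions.
    refine ⟨{ carrier := N.carrier
              coact := rightCoeff.symm.toLinearMap ∘ₗ N.δ
              coassoc := (rightCoeff_coassoc_iff _).2 fun m p q => ?_
              lTensor_counit_comp_coact := (rightCoeff_counit_iff _).2 fun m => ?_ },
      ⟨⟨⟨LinearMap.id, fun m p => ?_⟩, ⟨LinearMap.id, fun m p => ?_⟩, rfl, rfl⟩⟩⟩
    · simp only [LinearMap.comp_apply, LinearEquiv.coe_coe, LinearEquiv.apply_symm_apply]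
      exact N.δ_δ m p q
    · simp only [LinearMap.comp_apply, LinearEquiv.coe_coe, LinearEquiv.apply_symm_apply]
      exact N.sum_δ m
    · simp [rightFunctor]
      rfl
    · simp [rightFunctor]
      rfl

instance : (rightFunctor.{u, v, w, t} K V).IsEquivalence where

theorem isRightSemiperfect_iff :
    IsRightSemiperfect K (PathCoalgebra K V) ↔ ∀ v : V, {p : QuiverPath V | p.tgt = v}.Finite :=
  (rightFunctor K V).asEquivalence.enoughProjectives_iff.trans PathRep.enoughProjectives_iff


/-- The functor sending a left comodule over the path coalgebra to the associated representation
of the paths. -/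
noncomputable def leftFunctor : LeftComodule.{u, max u v w, t} K (PathCoalgebra K V) ⥤
    PathRep.{u, max v w, v, t} K (system V).op where
  obj M :=
    { carrier := M.carrier
      δ := leftCoeff.toLinearMap ∘ₗ M.coact
      δ_δ := (leftCoeff_coassoc_iff M.coact).1 M.coassoc
      sum_δ := (leftCoeff_counit_iff M.coact).1 M.rTensor_counit_comp_coact }
  map f := ⟨f.toLinearMap, (leftCoeff_comm_iff _ _ _).1 f.comm⟩

instance : (leftFunctor.{u, v, w, t} K V).Faithful where
  map_injective h := LeftComodule.Hom.ext (congrArg PathRep.Hom.toLinearMap h)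

instance : (leftFunctor.{u, v, w, t} K V).Full where
  map_surjective f := ⟨⟨f.toLinearMap, (leftCoeff_comm_iff _ _ _).2 f.comm⟩, rfl⟩

instance : (leftFunctor.{u, v, w, t} K V).EssSurj where
  mem_essImage N := by
    refine ⟨{ carrier := N.carrier
              coact := leftCoeff.symm.toLinearMap ∘ₗ N.δ
              coassoc := (leftCoeff_coassoc_iff _).2 fun m p q => ?_
              rTensor_counit_comp_coact := (leftCoeff_counit_iff _).2 fun m => ?_ },
      ⟨⟨⟨LinearMap.id, fun m p => ?_⟩, ⟨LinearMap.id, fun m p => ?_⟩, rfl, rfl⟩⟩⟩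
    · simp only [LinearMap.comp_apply, LinearEquiv.coe_coe, LinearEquiv.apply_symm_apply]
      exact N.δ_δ m p q
    · simp only [LinearMap.comp_apply, LinearEquiv.coe_coe, LinearEquiv.apply_symm_apply]
      exact N.sum_δ m
    · simp [leftFunctor]
      rfl
    · simp [leftFunctor]
      rfl

instance : (leftFunctor.{u, v, w, t} K V).IsEquivalence where

theorem isLeftSemiperfect_iff :
    IsLeftSemiperfect K (PathCoalgebra K V) ↔ ∀ v : V, {p : QuiverPath V | p.src = v}.Finite :=
  (leftFunctor K V).asEquivalence.enoughProjectives_iff.trans PathRep.enoughProjectives_iff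

end PathCoalgebra

theorem theorem3p6 {K : Type*} [Field K] {V : Type*} [Quiver V] :
    List.TFAE [
      Set.range (QuiverAlgebra.toDual (K := K) (V := V)) =
        leftRationalPart K (PathCoalgebra K V),
      Set.range (QuiverAlgebra.toDual (K := K) (V := V)) =
        rightRationalPart K (PathCoalgebra K V),
      ∀ v : V, {p : QuiverPath V | p.src = v}.Finite ∧ {p : QuiverPath V | p.tgt = v}.Finite,
      IsLeftSemiperfect K (PathCoalgebra K V) ∧ IsRightSemiperfect K (PathCoalgebra K V)] := by
  tfae_have 1 ↔ 3 := PathCoalgebra.range_toDual_eq_leftRationalPart_iff K V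
  tfae_have 2 ↔ 3 := PathCoalgebra.range_toDual_eq_rightRationalPart_iff K V
  tfae_have 3 ↔ 4 := by
    rw [PathCoalgebra.isLeftSemiperfect_iff, PathCoalgebra.isRightSemiperfect_iff, forall_and]
  tfae_finish
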